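/- For $0\le k<1$ let $K(k)=\int_0^{\pi/2}\frac{d\theta}{\sqrt{1-k^2\sin^2\theta}}$ and $E(k)=\int_0^{\pi/2}\sqrt{1-k^2\sin^2\theta}\,d\theta$ be the complete elliptic integrals of the first and second kind, let $\mathrm{cn}(u,k)$ and $\mathrm{dn}(u,k)$ be the Jacobi elliptic functions with modulus $k$, and put $L(k)=2K(k)\bigl(2E(k)-K(k)(1-k^2)\bigr)$. **Theorem.** Let $r>\frac{\pi^2}{2}$. There is exactly one $k\in[0,1)$ with $L(k)=r$, and it satisfies $k>0$. For this $k=L^{-1}(r)$ put $$a=\frac{K(k)(1+k)^2}{2E(k)-K(k)(1-k^2)},\qquad b=\frac{K(k)(1-k)^2}{2E(k)-K(k)(1-k^2)},\qquad \beta=\sqrt{\tfrac r2}\,(\sqrt a+\sqrt b).$$ Then $a>0$, $b>0$, and $$k=\frac{\sqrt a-\sqrt b}{\sqrt a+\sqrt b},\qquad \beta=2K(k),\qquad (\sqrt a+\sqrt b)\sqrt{\tfrac2r}\,E(k)-\sqrt{ab}=1 .$$ The function $$x(t)=a\left(\frac{\mathrm{dn}(\beta t,k)+k\,\mathrm{cn}(\beta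 t,k)}{1+k}\right)^2=a\left(\frac{1-k}{\mathrm{dn}(\beta t,k)-k\,\mathrm{cn}(\beta t,k)}\right)^2,\qquad t\in\mathbb R,$$ is a positive, nonconstant periodic solution of period $2$, i.e. $x(t)=x(t-2)$ for all $t\in\mathbb R$, of the delay differential equation $$x'(t)=r\,x(t)\left(1-\int_0^1 x(t-s)\,ds\right),\qquad t\in\mathbb R,$$ and for every $t\in\mathbb R$ it satisfies $$x(t)\,x(t-1)=ab,\qquad \int_0^2 x(t-s)\,ds=2 .$$ -/

import Mathlib

open Set

noncomputable section

/-- The complete elliptic integral of the first kind, as a function of the modulus `k`. -/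
def ellipticK (k : ℝ) : ℝ :=
  ∫ θ in (0 : ℝ)..(Real.pi / 2), 1 / Real.sqrt (1 - k ^ 2 * Real.sin θ ^ 2)

/-- The complete elliptic integral of the second kind, as a function of the modulus `k`. -/
def ellipticE (k : ℝ) : ℝ :=
  ∫ θ in (0 : ℝ)..(Real.pi / 2), Real.sqrt (1 - k ^ 2 * Real.sin θ ^ 2)

/-- The incomplete elliptic integral of the first kind with modulus `k` and amplitude `φ`. -/
def ellipticF (k φ : ℝ) : ℝ :=
  ∫ θ in (0 : ℝ)..φ, 1 / Real.sqrt (1 - k ^ 2 * Real.sin θ ^ 2)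

/-- For a modulus `0 ≤ k < 1` the incomplete elliptic integral of the first kind is a bijection of
the real line, so that its inverse function, the Jacobi amplitude, is well defined. -/
theorem ellipticF_bijective {k : ℝ} (hk : k ∈ Ico (0 : ℝ) 1) :
    Function.Bijective (ellipticF k) := by
  have hpos : ∀ θ : ℝ, 0 < 1 - k ^ 2 * Real.sin θ ^ 2 := by
    intro θ
    have h1 : Real.sin θ ^ 2 ≤ 1 := Real.sin_sq_le_one θ
    have h2 : k ^ 2 < 1 := by nlinarith [hk.1, hk.2]
    nlinarith [sq_nonneg k, sq_nonneg (Real.sin θ)]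
  have hcont : Continuous fun θ : ℝ => 1 / Real.sqrt (1 - k ^ 2 * Real.sin θ ^ 2) :=
    continuous_const.div (by fun_prop) fun θ => (Real.sqrt_pos.2 (hpos θ)).ne'
  have hge : ∀ θ : ℝ, 1 ≤ 1 / Real.sqrt (1 - k ^ 2 * Real.sin θ ^ 2) := by
    intro θ
    rw [le_div_iff₀ (Real.sqrt_pos.2 (hpos θ)), one_mul]
    exact Real.sqrt_le_one.2 (by nlinarith [mul_nonneg (sq_nonneg k) (sq_nonneg (Real.sin θ))])
  have hF : Continuous (ellipticF k) :=
    intervalIntegral.continuous_primitive (fun a b => hcont.intervalIntegrable a b) 0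
  have hgrow : ∀ u v : ℝ, u ≤ v → v - u ≤ ellipticF k v - ellipticF k u := by
    intro u v huv
    have h1 : ellipticF k v - ellipticF k u
        = ∫ θ in u..v, 1 / Real.sqrt (1 - k ^ 2 * Real.sin θ ^ 2) :=
      intervalIntegral.integral_interval_sub_left
        (hcont.intervalIntegrable _ _) (hcont.intervalIntegrable _ _)
    have h2 := intervalIntegral.integral_mono_on huv
      (continuous_const.intervalIntegrable (μ := MeasureTheory.volume) u v)
      (hcont.intervalIntegrable u v) (fun θ _ => hge θ)
    rw [h1]
    simpa using h2
  have h0 : ellipticF k 0 = 0 := by simp [ellipticF]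
  refine ⟨StrictMono.injective fun u v huv => ?_, fun y => ?_⟩
  · have := hgrow u v huv.le
    linarith
  · have h1 := hgrow 0 |y| (abs_nonneg y)
    have h2 := hgrow (-|y|) 0 (by linarith [abs_nonneg y])
    have hy : y ∈ Icc (ellipticF k (-|y|)) (ellipticF k |y|) :=
      ⟨by linarith [neg_abs_le y], by linarith [le_abs_self y]⟩
    obtain ⟨φ, -, hφ⟩ := intermediate_value_Icc
      (by linarith [abs_nonneg y] : -|y| ≤ |y|) hF.continuousOn hy
    exact ⟨φ, hφ⟩

/-- The Jacobi amplitude `am(u, k)`: the inverse function of `φ ↦ F(φ, k)`. -/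
def jacobiAm (u k : ℝ) : ℝ := Function.invFun (ellipticF k) u

/-- The Jacobi elliptic function `sn(u, k) = sin (am(u, k))`, with modulus `k`. -/
def jacobiSn (u k : ℝ) : ℝ := Real.sin (jacobiAm u k)

/-- The Jacobi elliptic function `cn(u, k) = cos (am(u, k))`, with modulus `k`. -/
def jacobiCn (u k : ℝ) : ℝ := Real.cos (jacobiAm u k)

/-- The Jacobi elliptic function `dn(u, k) = √(1 - k² sn²(u, k))`, with modulus `k`. -/
def jacobiDn (u k : ℝ) : ℝ := Real.sqrt (1 - k ^ 2 * jacobiSn u k ^ 2)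

/-- The function `L(k) = 2 K(k) (2 E(k) - K(k) (1 - k²))`, considered on `0 ≤ k < 1`. -/
def ellipticL (k : ℝ) : ℝ :=
  2 * ellipticK k * (2 * ellipticE k - ellipticK k * (1 - k ^ 2))

/-- `x : ℝ → ℝ` solves `x'(t) = r x(t) (1 - ∫₀¹ x(t - s) ds)` for every real `t`. -/
def IsDelaySolution (r : ℝ) (x : ℝ → ℝ) : Prop :=
  ∀ t : ℝ, HasDerivAt x (r * x t * (1 - ∫ s in (0 : ℝ)..1, x (t - s))) t

end

open Set

/-! Write D = 2E - (1 - k²)K, so that L = 2KD. In the variable u = 2Kt the delay 1 becomes the shift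
2K, which lowers the amplitude by π: it fixes dn and reverses sn and cn. The profile y = (dn + k
cn)² has logarithmic derivative -2k sn (`hasDerivAt_dnCnSq`), and its integral over [u - 2K, u] is
2D + 4k sn u (`integral_dnCnSq`). Hence for x(t) = (K/D) y(2Kt) both x'/x and 1 - ∫x are multiples
of sn, namely -4kK sn and -(2k/D) sn. Their ratio is 2KD, so x solves the equation exactly for r =
L(k). The product law comes from (dn + k cn)(dn - k cn) = 1 - k², and the integral over a period is
2 because the sn terms of its two halves cancel. The modulus exists and is unique because L is
continuous and strictly increasing on [0,1), starts at π²/2 and is unbounded: K grows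
logarithmically in 1/√(1 - k²), while D is monotone and at least π/2. -/

/-- The Legendre radical `Δ(θ) = √(1 - k² sin² θ)`. -/
noncomputable def legendreDelta (k θ : ℝ) : ℝ := Real.sqrt (1 - k ^ 2 * Real.sin θ ^ 2)

theorem legendre_radicand_pos {k : ℝ} (hk : k ∈ Ico (0 : ℝ) 1) (θ : ℝ) :
    0 < 1 - k ^ 2 * Real.sin θ ^ 2 := by
  have h1 : Real.sin θ ^ 2 ≤ 1 := Real.sin_sq_le_one θ
  have h2 : k ^ 2 < 1 := by nlinarith [hk.1, hk.2]
  nlinarith [sq_nonneg k, sq_nonneg (Real.sin θ)]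

theorem legendreDelta_pos {k : ℝ} (hk : k ∈ Ico (0 : ℝ) 1) (θ : ℝ) : 0 < legendreDelta k θ :=
  Real.sqrt_pos.2 (legendre_radicand_pos hk θ)

theorem legendreDelta_sq {k : ℝ} (hk : k ∈ Ico (0 : ℝ) 1) (θ : ℝ) :
    legendreDelta k θ ^ 2 = 1 - k ^ 2 * Real.sin θ ^ 2 :=
  Real.sq_sqrt (legendre_radicand_pos hk θ).le

theorem continuous_legendreDelta (k : ℝ) : Continuous (legendreDelta k) := by
  unfold legendreDelta
  fun_prop

theorem continuous_inv_legendreDelta {k : ℝ} (hk : k ∈ Ico (0 : ℝ) 1) :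
    Continuous fun θ => 1 / legendreDelta k θ :=
  continuous_const.div (continuous_legendreDelta k) fun θ => (legendreDelta_pos hk θ).ne'

theorem hasDerivAt_legendreDelta {k : ℝ} (hk : k ∈ Ico (0 : ℝ) 1) (θ : ℝ) :
    HasDerivAt (legendreDelta k)
      (-(k ^ 2 * Real.sin θ * Real.cos θ) / legendreDelta k θ) θ := by
  have h := ((((Real.hasDerivAt_sin θ).pow 2).const_mul (k ^ 2)).const_sub 1).sqrt
    (legendre_radicand_pos hk θ).ne'
  refine h.congr_deriv ?_
  rw [Pi.pow_apply, ← legendreDelta, neg_div, neg_div, neg_inj,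
    ← mul_div_mul_left (k ^ 2 * Real.sin θ * Real.cos θ) _ two_ne_zero]
  push_cast
  ring

theorem ellipticK_eq (k : ℝ) :
    ellipticK k = ∫ θ in (0 : ℝ)..(Real.pi / 2), 1 / legendreDelta k θ := rfl

theorem ellipticE_eq (k : ℝ) :
    ellipticE k = ∫ θ in (0 : ℝ)..(Real.pi / 2), legendreDelta k θ := rfl

theorem ellipticF_eq (k φ : ℝ) :
    ellipticF k φ = ∫ θ in (0 : ℝ)..φ, 1 / legendreDelta k θ := rfl

/-! ### The combination `2 E - (1 - k²) K` -/

/-- The combination `2 E(k) - (1 - k²) K(k)`. -/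
noncomputable def ellipticD (k : ℝ) : ℝ := 2 * ellipticE k - ellipticK k * (1 - k ^ 2)

theorem ellipticL_eq (k : ℝ) : ellipticL k = 2 * ellipticK k * ellipticD k := rfl

/-- The integrand of `2 E(k) - (1 - k²) K(k)`. -/
noncomputable def ellipticDIntegrand (k θ : ℝ) : ℝ :=
  2 * legendreDelta k θ - (1 / legendreDelta k θ) * (1 - k ^ 2)

theorem continuous_ellipticDIntegrand {k : ℝ} (hk : k ∈ Ico (0 : ℝ) 1) :
    Continuous (ellipticDIntegrand k) :=
  (continuous_const.mul (continuous_legendreDelta k)).sub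
    ((continuous_inv_legendreDelta hk).mul continuous_const)

theorem ellipticD_eq_integral {k : ℝ} (hk : k ∈ Ico (0 : ℝ) 1) :
    ellipticD k = ∫ θ in (0 : ℝ)..(Real.pi / 2), ellipticDIntegrand k θ := by
  unfold ellipticDIntegrand ellipticD
  have h1 : Continuous fun θ => 2 * legendreDelta k θ :=
    continuous_const.mul (continuous_legendreDelta k)
  have h2 : Continuous fun θ => 1 / legendreDelta k θ * (1 - k ^ 2) :=
    (continuous_inv_legendreDelta hk).mul continuous_const
  rw [intervalIntegral.integral_sub (h1.intervalIntegrable _ _) (h2.intervalIntegrable _ _),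
    intervalIntegral.integral_const_mul, intervalIntegral.integral_mul_const,
    ellipticK_eq, ellipticE_eq]

theorem continuous_one_add_sq_mul_cos_sq_div {k : ℝ} (hk : k ∈ Ico (0 : ℝ) 1) :
    Continuous fun θ => 1 + k ^ 2 * Real.cos θ ^ 2 / (1 + legendreDelta k θ) := by
  refine continuous_const.add (Continuous.div (by fun_prop)
    (continuous_const.add (continuous_legendreDelta k)) fun θ => ?_)
  have := legendreDelta_pos hk θ
  positivity

/-- A representation of `2 E - (1 - k²) K` whose integrand is increasing in `k`. -/
theorem ellipticD_eq_integral_monotone {k : ℝ} (hk : k ∈ Ico (0 : ℝ) 1) :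
    ellipticD k = ∫ θ in (0 : ℝ)..(Real.pi / 2),
      (1 + k ^ 2 * Real.cos θ ^ 2 / (1 + legendreDelta k θ)) := by
  -- The original integrand of D is not monotone in k: it increases at θ = 0 and decreases at θ =
  -- π/2. Subtracting an exact derivative whose primitive vanishes at both endpoints repairs this
  -- without changing the integral.
  have hder : ∀ θ : ℝ, HasDerivAt
      (fun θ => k ^ 2 * (Real.sin θ * Real.cos θ) / (1 + legendreDelta k θ))
      (ellipticDIntegrand k θ - (1 + k ^ 2 * Real.cos θ ^ 2 / (1 + legendreDelta k θ))) θ := by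
    intro θ
    have hp := legendreDelta_pos hk θ
    have h := (((Real.hasDerivAt_sin θ).mul (Real.hasDerivAt_cos θ)).const_mul (k ^ 2)).div
      ((hasDerivAt_legendreDelta hk θ).const_add 1) (by positivity)
    refine h.congr_deriv ?_
    have h1 := legendreDelta_sq hk θ
    have h2 : k ^ 2 * Real.cos θ ^ 2 = k ^ 2 - 1 + legendreDelta k θ ^ 2 := by
      rw [h1, Real.cos_sq']; ring
    have h3 : k ^ 2 * Real.sin θ ^ 2 = 1 - legendreDelta k θ ^ 2 := by linarith
    have e : k ^ 2 * (Real.cos θ * Real.cos θ + Real.sin θ * -Real.sin θ)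
          * (1 + legendreDelta k θ)
        - k ^ 2 * (Real.sin θ * Real.cos θ)
          * (-(k ^ 2 * Real.sin θ * Real.cos θ) / legendreDelta k θ)
        = (k ^ 2 * Real.cos θ ^ 2 - k ^ 2 * Real.sin θ ^ 2) * (1 + legendreDelta k θ)
          + (k ^ 2 * Real.sin θ ^ 2) * (k ^ 2 * Real.cos θ ^ 2) / legendreDelta k θ := by ring
    simp only [Pi.mul_apply]
    rw [e, h2, h3, ellipticDIntegrand]
    have h4 : 1 + legendreDelta k θ ≠ 0 := by positivity
    field_simp
    ring
  have hc1 := continuous_ellipticDIntegrand hk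
  have hc2 := continuous_one_add_sq_mul_cos_sq_div hk
  have h := intervalIntegral.integral_eq_sub_of_hasDerivAt (a := 0) (b := Real.pi / 2)
    (fun θ _ => hder θ) ((hc1.sub hc2).intervalIntegrable _ _)
  rw [intervalIntegral.integral_sub (hc1.intervalIntegrable _ _) (hc2.intervalIntegrable _ _)] at h
  simp only [Real.sin_zero, Real.cos_pi_div_two, zero_mul, mul_zero, zero_div, sub_zero] at h
  rw [ellipticD_eq_integral hk]
  linarith

/-! ### Monotonicity in the modulus -/

theorem legendreDelta_anti {k l : ℝ} (hk : 0 ≤ k) (hkl : k ≤ l) (θ : ℝ) :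
    legendreDelta l θ ≤ legendreDelta k θ := by
  unfold legendreDelta
  gcongr

theorem ellipticD_mono {k l : ℝ} (hk : k ∈ Ico (0 : ℝ) 1) (hl : l ∈ Ico (0 : ℝ) 1)
    (hkl : k ≤ l) : ellipticD k ≤ ellipticD l := by
  rw [ellipticD_eq_integral_monotone hk, ellipticD_eq_integral_monotone hl]
  refine intervalIntegral.integral_mono_on (by positivity)
    ((continuous_one_add_sq_mul_cos_sq_div hk).intervalIntegrable _ _)
    ((continuous_one_add_sq_mul_cos_sq_div hl).intervalIntegrable _ _) fun θ _ => ?_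
  have h0 := hk.1
  have h1 := legendreDelta_pos hl θ
  have h2 := legendreDelta_anti hk.1 hkl θ
  gcongr

theorem legendreDelta_zero (θ : ℝ) : legendreDelta 0 θ = 1 := by simp [legendreDelta]

theorem ellipticK_zero : ellipticK 0 = Real.pi / 2 := by
  simp [ellipticK_eq, legendreDelta_zero]

theorem ellipticE_zero : ellipticE 0 = Real.pi / 2 := by
  simp [ellipticE_eq, legendreDelta_zero]

theorem ellipticD_zero : ellipticD 0 = Real.pi / 2 := by
  rw [ellipticD, ellipticK_zero, ellipticE_zero]; ring

theorem ellipticL_zero : ellipticL 0 = Real.pi ^ 2 / 2 := by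
  rw [ellipticL_eq, ellipticK_zero, ellipticD_zero]; ring

theorem pi_div_two_le_ellipticD {k : ℝ} (hk : k ∈ Ico (0 : ℝ) 1) :
    Real.pi / 2 ≤ ellipticD k :=
  ellipticD_zero ▸ ellipticD_mono (by simp) hk hk.1

theorem ellipticD_pos {k : ℝ} (hk : k ∈ Ico (0 : ℝ) 1) : 0 < ellipticD k :=
  lt_of_lt_of_le (by positivity) (pi_div_two_le_ellipticD hk)

theorem ellipticK_strictMono {k l : ℝ} (hk : k ∈ Ico (0 : ℝ) 1) (hl : l ∈ Ico (0 : ℝ) 1)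
    (hkl : k < l) : ellipticK k < ellipticK l := by
  rw [ellipticK_eq, ellipticK_eq]
  -- The integrands agree at θ = 0; strictness is witnessed at θ = π/2, where sin θ = 1.
  refine intervalIntegral.integral_lt_integral_of_continuousOn_of_le_of_exists_lt (by positivity)
    (continuous_inv_legendreDelta hk).continuousOn (continuous_inv_legendreDelta hl).continuousOn
    (fun θ _ => one_div_le_one_div_of_le (legendreDelta_pos hl θ)
      (legendreDelta_anti hk.1 hkl.le θ)) ⟨Real.pi / 2, ⟨by positivity, le_rfl⟩, ?_⟩
  refine one_div_lt_one_div_of_lt (legendreDelta_pos hl _) ?_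
  refine Real.sqrt_lt_sqrt (legendre_radicand_pos hl _).le ?_
  have : k ^ 2 < l ^ 2 := by nlinarith [hk.1]
  simpa using this

theorem ellipticK_pos {k : ℝ} (hk : k ∈ Ico (0 : ℝ) 1) : 0 < ellipticK k := by
  rcases hk.1.eq_or_lt with rfl | h
  · rw [ellipticK_zero]; positivity
  · have := ellipticK_strictMono (k := 0) (by simp) hk h
    rw [ellipticK_zero] at this
    exact lt_trans (by positivity) this

theorem ellipticL_strictMonoOn : StrictMonoOn ellipticL (Ico 0 1) := by
  intro k hk l hl hkl
  rw [ellipticL_eq, ellipticL_eq]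
  have h1 := ellipticK_strictMono hk hl hkl
  have h2 := ellipticD_mono hk hl hkl.le
  have h3 := ellipticK_pos hk
  have h4 := ellipticD_pos hk
  nlinarith

/-! ### Continuity and growth of `L` -/

theorem continuous_ellipticE : Continuous ellipticE := by
  refine intervalIntegral.continuous_parametric_intervalIntegral_of_continuous' ?_ _ _
  unfold Function.uncurry
  fun_prop

theorem continuousOn_ellipticK {q : ℝ} (hq : q ∈ Ico (0 : ℝ) 1) :
    ContinuousOn ellipticK (Icc 0 q) := by
  -- Truncating the modulus to [0, q] makes the integrand jointly continuous for all real k without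
  -- changing it on [0, q].
  have hmem : ∀ k : ℝ, min |k| q ∈ Ico (0 : ℝ) 1 := fun k =>
    ⟨le_min (abs_nonneg k) hq.1, (min_le_right _ _).trans_lt hq.2⟩
  have h : Continuous fun k => ellipticK (min |k| q) := by
    refine intervalIntegral.continuous_parametric_intervalIntegral_of_continuous' ?_ _ _
    refine continuous_const.div (by fun_prop) fun p => ?_
    exact (legendreDelta_pos (hmem p.1) p.2).ne'
  refine h.continuousOn.congr fun k hk => ?_
  simp only [abs_of_nonneg hk.1, min_eq_left hk.2]

theorem continuousOn_ellipticL {q : ℝ} (hq : q ∈ Ico (0 : ℝ) 1) :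
    ContinuousOn ellipticL (Icc 0 q) := by
  have h1 := continuousOn_ellipticK hq
  have h2 : ContinuousOn ellipticE (Icc 0 q) := continuous_ellipticE.continuousOn
  unfold ellipticL
  fun_prop

/-- The logarithmic lower bound for `K` near `k = 1`. -/
theorem log_le_ellipticK {k ε : ℝ} (hk : k ∈ Ico (0 : ℝ) 1) (hε : 0 < ε)
    (h : 1 - k ^ 2 = ε ^ 2) : Real.log ((ε + Real.pi / 2) / ε) ≤ ellipticK k := by
  have hpi : 0 < Real.pi / 2 := by positivity
  -- Comparison function: Δ² = ε² + k² cos² θ ≤ ε² + (π/2 - θ)², hence Δ ≤ ε + π/2 - θ.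
  have hI : ∫ θ in (0 : ℝ)..(Real.pi / 2), (ε + Real.pi / 2 - θ)⁻¹
      = Real.log ((ε + Real.pi / 2) / ε) := by
    rw [intervalIntegral.integral_comp_sub_left (fun y => y⁻¹) (ε + Real.pi / 2),
      integral_inv_of_pos (by linarith) (by linarith)]
    congr 1
    ring
  rw [← hI, ellipticK_eq]
  refine intervalIntegral.integral_mono_on hpi.le ?_
    ((continuous_inv_legendreDelta hk).intervalIntegrable _ _) fun θ hθ => ?_
  · refine ContinuousOn.intervalIntegrable ?_
    refine ContinuousOn.inv₀ (by fun_prop) fun θ hθ => ?_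
    rw [uIcc_of_le hpi.le] at hθ
    have := hθ.2
    exact ne_of_gt (by linarith)
  · rw [inv_eq_one_div]
    refine one_div_le_one_div_of_le (legendreDelta_pos hk θ) ?_
    have h0 : 0 ≤ Real.pi / 2 - θ := by linarith [hθ.2]
    refine Real.sqrt_le_iff.2 ⟨by linarith, ?_⟩
    have hc : Real.cos θ ≤ Real.pi / 2 - θ := by
      rw [← Real.sin_pi_div_two_sub]; exact Real.sin_le h0
    have hc0 : 0 ≤ Real.cos θ := Real.cos_nonneg_of_mem_Icc ⟨by linarith [hθ.1], hθ.2⟩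
    have hs := Real.sin_sq_add_cos_sq θ
    have hk1 : k ^ 2 ≤ 1 := by nlinarith [hk.1, hk.2]
    have e : 1 - k ^ 2 * Real.sin θ ^ 2 = ε ^ 2 + k ^ 2 * Real.cos θ ^ 2 := by
      rw [← h]; linear_combination -k ^ 2 * hs
    have h5 : k ^ 2 * Real.cos θ ^ 2 ≤ Real.cos θ ^ 2 := by nlinarith [sq_nonneg (Real.cos θ)]
    rw [e]
    nlinarith [mul_nonneg hε.le h0]

theorem exists_le_ellipticK (M : ℝ) : ∃ k ∈ Ico (0 : ℝ) 1, M ≤ ellipticK k := by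
  -- With this ε, e^M ε ≤ 1 ≤ ε + π/2, so the logarithmic bound is at least M; the absolute value
  -- ensures ε ≤ 1, making √(1 - ε²) a valid modulus.
  set ε := Real.exp (-|M|) with hεdef
  have hε : 0 < ε := Real.exp_pos _
  have hε1 : ε ≤ 1 := Real.exp_le_one_iff.2 (by linarith [abs_nonneg M])
  have hsq : ε ^ 2 ≤ 1 := by nlinarith
  have hmem : Real.sqrt (1 - ε ^ 2) ∈ Ico (0 : ℝ) 1 := by
    refine ⟨Real.sqrt_nonneg _, ?_⟩
    rw [Real.sqrt_lt' one_pos]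
    nlinarith
  refine ⟨_, hmem, ?_⟩
  refine le_trans ?_ (log_le_ellipticK hmem hε (by rw [Real.sq_sqrt (by linarith)]; ring))
  rw [Real.le_log_iff_exp_le (by positivity), le_div_iff₀ hε, hεdef, ← Real.exp_add]
  have h1 : Real.exp (M + -|M|) ≤ 1 := Real.exp_le_one_iff.2 (by linarith [le_abs_self M])
  have := Real.pi_gt_three
  linarith [Real.exp_pos (-|M|)]

theorem exists_ellipticL_eq {r : ℝ} (hr : Real.pi ^ 2 / 2 < r) :
    ∃ k ∈ Ioo (0 : ℝ) 1, ellipticL k = r := by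
  -- Since D ≥ π/2, L ≥ πK, so K ≥ r/π forces L ≥ r.
  obtain ⟨q, hq, hM⟩ := exists_le_ellipticK (r / Real.pi)
  have hr0 : 0 < r := lt_trans (by positivity) hr
  have hL : r ≤ ellipticL q := by
    rw [ellipticL_eq]
    have h1 := pi_div_two_le_ellipticD hq
    have h2 := ellipticK_pos hq
    rw [div_le_iff₀ Real.pi_pos] at hM
    nlinarith
  obtain ⟨k, hk, hkr⟩ := intermediate_value_Icc hq.1 (continuousOn_ellipticL hq)
    ⟨by rw [ellipticL_zero]; exact hr.le, hL⟩
  refine ⟨k, ⟨lt_of_le_of_ne hk.1 ?_, hk.2.trans_lt hq.2⟩, hkr⟩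
  rintro rfl
  rw [ellipticL_zero] at hkr
  exact hr.ne hkr

/-! ### Period integrals -/

theorem legendreDelta_add_pi (k θ : ℝ) : legendreDelta k (θ + Real.pi) = legendreDelta k θ := by
  simp [legendreDelta, Real.sin_add_pi]

theorem legendreDelta_pi_sub (k θ : ℝ) : legendreDelta k (Real.pi - θ) = legendreDelta k θ := by
  simp [legendreDelta, Real.sin_pi_sub]

/-- Periodicity moves the interval to [0, π], and the reflection folds its second half onto the
first. -/
theorem integral_sub_pi_eq_two_mul {f : ℝ → ℝ} (hf : Continuous f)
    (hper : Function.Periodic f Real.pi) (hrefl : ∀ θ, f (Real.pi - θ) = f θ) (φ : ℝ) :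
    ∫ θ in (φ - Real.pi)..φ, f θ = 2 * ∫ θ in (0 : ℝ)..(Real.pi / 2), f θ := by
  have h1 := hper.intervalIntegral_add_eq (φ - Real.pi) 0
  rw [sub_add_cancel, zero_add] at h1
  have h2 := intervalIntegral.integral_comp_sub_left f Real.pi (a := 0) (b := Real.pi / 2)
  simp only [hrefl, sub_zero, sub_half] at h2
  rw [h1, ← intervalIntegral.integral_add_adjacent_intervals
    (hf.intervalIntegrable 0 (Real.pi / 2)) (hf.intervalIntegrable (Real.pi / 2) Real.pi), ← h2]
  ring

theorem ellipticF_sub_pi {k : ℝ} (hk : k ∈ Ico (0 : ℝ) 1) (φ : ℝ) :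
    ellipticF k (φ - Real.pi) = ellipticF k φ - 2 * ellipticK k := by
  have hc := continuous_inv_legendreDelta hk
  have h := integral_sub_pi_eq_two_mul hc
    (fun θ => by simp only [legendreDelta_add_pi]) (fun θ => by rw [legendreDelta_pi_sub]) φ
  have h2 := intervalIntegral.integral_add_adjacent_intervals (μ := MeasureTheory.volume)
    (hc.intervalIntegrable 0 (φ - Real.pi)) (hc.intervalIntegrable (φ - Real.pi) φ)
  rw [ellipticF_eq, ellipticF_eq, ellipticK_eq]
  linarith

theorem integral_ellipticDIntegrand_sub_pi {k : ℝ} (hk : k ∈ Ico (0 : ℝ) 1) (φ : ℝ) :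
    ∫ θ in (φ - Real.pi)..φ, ellipticDIntegrand k θ = 2 * ellipticD k := by
  rw [ellipticD_eq_integral hk]
  exact integral_sub_pi_eq_two_mul (continuous_ellipticDIntegrand hk)
    (fun θ => by simp only [ellipticDIntegrand, legendreDelta_add_pi])
    (fun θ => by simp only [ellipticDIntegrand, legendreDelta_pi_sub]) φ

/-! ### The Jacobi amplitude -/

theorem hasDerivAt_ellipticF {k : ℝ} (hk : k ∈ Ico (0 : ℝ) 1) (φ : ℝ) :
    HasDerivAt (ellipticF k) (1 / legendreDelta k φ) φ :=
  intervalIntegral.integral_hasDerivAt_right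
    ((continuous_inv_legendreDelta hk).intervalIntegrable _ _)
    ((continuous_inv_legendreDelta hk).stronglyMeasurableAtFilter _ _)
    (continuous_inv_legendreDelta hk).continuousAt

theorem ellipticF_strictMono {k : ℝ} (hk : k ∈ Ico (0 : ℝ) 1) : StrictMono (ellipticF k) :=
  strictMono_of_hasDerivAt_pos (hasDerivAt_ellipticF hk)
    fun φ => one_div_pos.2 (legendreDelta_pos hk φ)

theorem ellipticF_jacobiAm {k : ℝ} (hk : k ∈ Ico (0 : ℝ) 1) (u : ℝ) :
    ellipticF k (jacobiAm u k) = u :=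
  Function.rightInverse_invFun (ellipticF_bijective hk).2 u

theorem jacobiAm_ellipticF {k : ℝ} (hk : k ∈ Ico (0 : ℝ) 1) (φ : ℝ) :
    jacobiAm (ellipticF k φ) k = φ :=
  Function.leftInverse_invFun (ellipticF_bijective hk).1 φ

theorem continuous_jacobiAm {k : ℝ} (hk : k ∈ Ico (0 : ℝ) 1) :
    Continuous fun u => jacobiAm u k := by
  refine Monotone.continuous_of_surjective (fun u v huv => ?_)
    fun φ => ⟨ellipticF k φ, jacobiAm_ellipticF hk φ⟩
  rw [← (ellipticF_strictMono hk).le_iff_le, ellipticF_jacobiAm hk, ellipticF_jacobiAm hk]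
  exact huv

theorem hasDerivAt_jacobiAm {k : ℝ} (hk : k ∈ Ico (0 : ℝ) 1) (u : ℝ) :
    HasDerivAt (fun u => jacobiAm u k) (jacobiDn u k) u := by
  have h := (hasDerivAt_ellipticF hk (jacobiAm u k)).of_local_left_inverse
    (continuous_jacobiAm hk).continuousAt
    (one_div_pos.2 (legendreDelta_pos hk _)).ne'
    (Filter.Eventually.of_forall (ellipticF_jacobiAm hk))
  rw [one_div, inv_inv] at h
  exact h

theorem jacobiAm_zero {k : ℝ} (hk : k ∈ Ico (0 : ℝ) 1) : jacobiAm 0 k = 0 := by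
  have := jacobiAm_ellipticF hk 0
  rwa [ellipticF_eq, intervalIntegral.integral_same] at this

/-- Source of every half-period symmetry of sn, cn and dn used below. -/
theorem jacobiAm_sub_two_mul_ellipticK {k : ℝ} (hk : k ∈ Ico (0 : ℝ) 1) (u : ℝ) :
    jacobiAm (u - 2 * ellipticK k) k = jacobiAm u k - Real.pi := by
  rw [← jacobiAm_ellipticF hk (jacobiAm u k - Real.pi), ellipticF_sub_pi hk, ellipticF_jacobiAm hk]

theorem jacobiDn_eq (u k : ℝ) : jacobiDn u k = legendreDelta k (jacobiAm u k) := rfl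

theorem jacobiDn_pos {k : ℝ} (hk : k ∈ Ico (0 : ℝ) 1) (u : ℝ) : 0 < jacobiDn u k :=
  legendreDelta_pos hk _

/-- Factored as (dn + k cn)(dn - k cn), this yields positivity, the product law and the equality of
the two formulas for x. -/
theorem jacobiDn_sq_sub {k : ℝ} (hk : k ∈ Ico (0 : ℝ) 1) (u : ℝ) :
    jacobiDn u k ^ 2 - k ^ 2 * jacobiCn u k ^ 2 = 1 - k ^ 2 := by
  rw [jacobiDn_eq, legendreDelta_sq hk, jacobiCn]
  linear_combination -k ^ 2 * Real.sin_sq_add_cos_sq (jacobiAm u k)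

theorem jacobiSn_sub_two_mul_ellipticK {k : ℝ} (hk : k ∈ Ico (0 : ℝ) 1) (u : ℝ) :
    jacobiSn (u - 2 * ellipticK k) k = -jacobiSn u k := by
  rw [jacobiSn, jacobiSn, jacobiAm_sub_two_mul_ellipticK hk, Real.sin_sub_pi]

theorem jacobiCn_sub_two_mul_ellipticK {k : ℝ} (hk : k ∈ Ico (0 : ℝ) 1) (u : ℝ) :
    jacobiCn (u - 2 * ellipticK k) k = -jacobiCn u k := by
  rw [jacobiCn, jacobiCn, jacobiAm_sub_two_mul_ellipticK hk, Real.cos_sub_pi]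

theorem jacobiDn_sub_two_mul_ellipticK {k : ℝ} (hk : k ∈ Ico (0 : ℝ) 1) (u : ℝ) :
    jacobiDn (u - 2 * ellipticK k) k = jacobiDn u k := by
  rw [jacobiDn, jacobiDn, jacobiSn_sub_two_mul_ellipticK hk, neg_sq]

theorem hasDerivAt_jacobiSn {k : ℝ} (hk : k ∈ Ico (0 : ℝ) 1) (u : ℝ) :
    HasDerivAt (fun u => jacobiSn u k) (jacobiCn u k * jacobiDn u k) u :=
  (hasDerivAt_jacobiAm hk u).sin

theorem hasDerivAt_jacobiCn {k : ℝ} (hk : k ∈ Ico (0 : ℝ) 1) (u : ℝ) :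
    HasDerivAt (fun u => jacobiCn u k) (-jacobiSn u k * jacobiDn u k) u :=
  (hasDerivAt_jacobiAm hk u).cos

theorem hasDerivAt_jacobiDn {k : ℝ} (hk : k ∈ Ico (0 : ℝ) 1) (u : ℝ) :
    HasDerivAt (fun u => jacobiDn u k) (-(k ^ 2 * jacobiSn u k * jacobiCn u k)) u := by
  have h := (hasDerivAt_legendreDelta hk (jacobiAm u k)).comp u (hasDerivAt_jacobiAm hk u)
  refine h.congr_deriv ?_
  rw [← jacobiDn_eq, div_mul_cancel₀ _ (jacobiDn_pos hk u).ne']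
  rfl

theorem abs_mul_jacobiCn_lt_jacobiDn {k : ℝ} (hk : k ∈ Ico (0 : ℝ) 1) (u : ℝ) :
    |k * jacobiCn u k| < jacobiDn u k := by
  refine abs_lt_of_sq_lt_sq ?_ (jacobiDn_pos hk u).le
  have := jacobiDn_sq_sub hk u
  nlinarith [hk.1, hk.2]

theorem jacobiDn_add_pos {k : ℝ} (hk : k ∈ Ico (0 : ℝ) 1) (u : ℝ) :
    0 < jacobiDn u k + k * jacobiCn u k := by
  linarith [(abs_lt.1 (abs_mul_jacobiCn_lt_jacobiDn hk u)).1]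

theorem jacobiDn_sub_pos {k : ℝ} (hk : k ∈ Ico (0 : ℝ) 1) (u : ℝ) :
    0 < jacobiDn u k - k * jacobiCn u k := by
  linarith [(abs_lt.1 (abs_mul_jacobiCn_lt_jacobiDn hk u)).2]

/-! ### The squared profile `(dn + k cn)²` -/

/-- The profile `(dn(u, k) + k cn(u, k))²`. -/
noncomputable def dnCnSq (k u : ℝ) : ℝ := (jacobiDn u k + k * jacobiCn u k) ^ 2

theorem dnCnSq_pos {k : ℝ} (hk : k ∈ Ico (0 : ℝ) 1) (u : ℝ) : 0 < dnCnSq k u :=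
  pow_pos (jacobiDn_add_pos hk u) 2

/-- The derivatives combine to (dn + k cn)' = -k sn (dn + k cn). -/
theorem hasDerivAt_dnCnSq {k : ℝ} (hk : k ∈ Ico (0 : ℝ) 1) (u : ℝ) :
    HasDerivAt (dnCnSq k) (-2 * k * jacobiSn u k * dnCnSq k u) u := by
  have h := ((hasDerivAt_jacobiDn hk u).add ((hasDerivAt_jacobiCn hk u).const_mul k)).pow 2
  refine h.congr_deriv ?_
  simp only [dnCnSq, Pi.add_apply]
  push_cast
  ring

theorem dnCnSq_mul_sub {k : ℝ} (hk : k ∈ Ico (0 : ℝ) 1) (u : ℝ) :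
    dnCnSq k u * dnCnSq k (u - 2 * ellipticK k) = (1 - k ^ 2) ^ 2 := by
  rw [dnCnSq, dnCnSq, jacobiDn_sub_two_mul_ellipticK hk, jacobiCn_sub_two_mul_ellipticK hk,
    ← jacobiDn_sq_sub hk u]
  ring

/-- Expanding, (dn + k cn)² = (2 dn² - (1 - k²)) + 2k cn dn. Under θ = am v the first part becomes
the integrand of D, integrated over a length π; the second is the derivative of 2k sn, and sn
changes sign across the interval. -/
theorem integral_dnCnSq {k : ℝ} (hk : k ∈ Ico (0 : ℝ) 1) (u : ℝ) :
    ∫ v in (u - 2 * ellipticK k)..u, dnCnSq k v = 2 * ellipticD k + 4 * k * jacobiSn u k := by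
  have hc := continuous_ellipticDIntegrand hk
  have hder : ∀ v : ℝ, HasDerivAt
      (fun v => (∫ θ in (0 : ℝ)..(jacobiAm v k), ellipticDIntegrand k θ) + 2 * k * jacobiSn v k)
      (dnCnSq k v) v := by
    intro v
    have h1 := (intervalIntegral.integral_hasDerivAt_right
      (hc.intervalIntegrable 0 (jacobiAm v k)) (hc.stronglyMeasurableAtFilter _ _)
      hc.continuousAt).comp v (hasDerivAt_jacobiAm hk v)
    refine (h1.add ((hasDerivAt_jacobiSn hk v).const_mul (2 * k))).congr_deriv ?_
    have h2 := jacobiDn_pos hk v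
    have h3 := jacobiDn_sq_sub hk v
    rw [ellipticDIntegrand, ← jacobiDn_eq, dnCnSq]
    field_simp
    linear_combination h3
  have hcont : Continuous (dnCnSq k) :=
    continuous_iff_continuousAt.2 fun v => (hasDerivAt_dnCnSq hk v).continuousAt
  rw [intervalIntegral.integral_eq_sub_of_hasDerivAt (fun v _ => hder v)
    (hcont.intervalIntegrable _ _), jacobiAm_sub_two_mul_ellipticK hk,
    jacobiSn_sub_two_mul_ellipticK hk, ← integral_ellipticDIntegrand_sub_pi hk (jacobiAm u k)]
  have h2 := intervalIntegral.integral_add_adjacent_intervals (μ := MeasureTheory.volume)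
    (hc.intervalIntegrable 0 (jacobiAm u k - Real.pi))
    (hc.intervalIntegrable (jacobiAm u k - Real.pi) (jacobiAm u k))
  linarith

/-! ### The delay equation for the rescaled profile -/

/-- The integral of the rescaled profile over one delay interval. -/
theorem integral_profile {k : ℝ} (hk : k ∈ Ico (0 : ℝ) 1) (t : ℝ) :
    ∫ s in (t - 1)..t, ellipticK k / ellipticD k * dnCnSq k (2 * ellipticK k * s)
      = 1 + 2 * k / ellipticD k * jacobiSn (2 * ellipticK k * t) k := by
  have hK := ellipticK_pos hk
  have hD := ellipticD_pos hk
  rw [intervalIntegral.integral_const_mul,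
    intervalIntegral.integral_comp_mul_left _ (by positivity : 2 * ellipticK k ≠ 0), mul_sub,
    mul_one, integral_dnCnSq hk, smul_eq_mul]
  field_simp
  ring

theorem hasDerivAt_profile {k : ℝ} (hk : k ∈ Ico (0 : ℝ) 1) (c t : ℝ) :
    HasDerivAt (fun t => c * dnCnSq k (2 * ellipticK k * t))
      (-(4 * k * ellipticK k) * jacobiSn (2 * ellipticK k * t) k
        * (c * dnCnSq k (2 * ellipticK k * t))) t := by
  have h := ((hasDerivAt_dnCnSq hk (2 * ellipticK k * t)).comp t
    ((hasDerivAt_id t).const_mul (2 * ellipticK k))).const_mul c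
  refine h.congr_deriv ?_
  ring

theorem isDelaySolution_profile {k : ℝ} (hk : k ∈ Ico (0 : ℝ) 1) :
    IsDelaySolution (ellipticL k)
      (fun t => ellipticK k / ellipticD k * dnCnSq k (2 * ellipticK k * t)) := by
  intro t
  refine (hasDerivAt_profile hk _ t).congr_deriv ?_
  have hD := ellipticD_pos hk
  have h := intervalIntegral.integral_comp_sub_left
    (fun s => ellipticK k / ellipticD k * dnCnSq k (2 * ellipticK k * s)) t (a := 0) (b := 1)
  rw [sub_zero, integral_profile hk] at h
  rw [h, ellipticL_eq]
  field_simp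
  ring

/-- The sn terms of two consecutive unit intervals cancel, each interval leaving 1. -/
theorem integral_profile_period {k : ℝ} (hk : k ∈ Ico (0 : ℝ) 1) (t : ℝ) :
    ∫ s in (0 : ℝ)..2, ellipticK k / ellipticD k * dnCnSq k (2 * ellipticK k * (t - s)) = 2 := by
  have hcont : Continuous
      (fun s => ellipticK k / ellipticD k * dnCnSq k (2 * ellipticK k * s)) :=
    continuous_iff_continuousAt.2 fun s => (hasDerivAt_profile hk _ s).continuousAt
  have h := intervalIntegral.integral_comp_sub_left
    (fun s => ellipticK k / ellipticD k * dnCnSq k (2 * ellipticK k * s)) t (a := 0) (b := 2)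
  have h1 := integral_profile hk (t - 1)
  rw [sub_sub, one_add_one_eq_two, mul_sub, mul_one, jacobiSn_sub_two_mul_ellipticK hk] at h1
  rw [h, sub_zero, ← intervalIntegral.integral_add_adjacent_intervals
    (hcont.intervalIntegrable (t - 2) (t - 1)) (hcont.intervalIntegrable (t - 1) t),
    integral_profile hk, h1]
  ring

/-! ### Parameters and conclusion -/

theorem theorem1 (r : ℝ) (hr : Real.pi ^ 2 / 2 < r) :
    ∃ k : ℝ, k ∈ Ioo (0 : ℝ) 1 ∧ ellipticL k = r ∧
      (∀ k' ∈ Ico (0 : ℝ) 1, ellipticL k' = r → k' = k) ∧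
      ∃ a b β : ℝ,
        0 < a ∧ 0 < b ∧
        a = ellipticK k / (2 * ellipticE k - ellipticK k * (1 - k ^ 2)) * (1 + k) ^ 2 ∧
        b = ellipticK k / (2 * ellipticE k - ellipticK k * (1 - k ^ 2)) * (1 - k) ^ 2 ∧
        k = (Real.sqrt a - Real.sqrt b) / (Real.sqrt a + Real.sqrt b) ∧
        β = Real.sqrt (r / 2) * (Real.sqrt a + Real.sqrt b) ∧
        β = 2 * ellipticK k ∧
        (Real.sqrt a + Real.sqrt b) * Real.sqrt (2 / r) * ellipticE k - Real.sqrt (a * b) = 1 ∧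
        ∃ x : ℝ → ℝ,
          (∀ t, x t = a * ((jacobiDn (β * t) k + k * jacobiCn (β * t) k) / (1 + k)) ^ 2) ∧
          (∀ t, x t = a * ((1 - k) / (jacobiDn (β * t) k - k * jacobiCn (β * t) k)) ^ 2) ∧
          IsDelaySolution r x ∧
          (∀ t, 0 < x t) ∧
          (∀ t, x t = x (t - 2)) ∧
          (∃ t, x t ≠ x 0) ∧
          (∀ t, x t * x (t - 1) = a * b) ∧
          (∀ t, (∫ s in (0 : ℝ)..2, x (t - s)) = 2) := by
  obtain ⟨k, hk, hL⟩ := exists_ellipticL_eq hr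
  have hk' : k ∈ Ico (0 : ℝ) 1 := ⟨hk.1.le, hk.2⟩
  have hK := ellipticK_pos hk'
  have hD := ellipticD_pos hk'
  have hk0 := hk.1
  have hk1 : 0 < 1 - k := sub_pos.2 hk.2
  refine ⟨k, hk, hL, fun k' hk'' h => ellipticL_strictMonoOn.injOn hk'' hk' (h.trans hL.symm), ?_⟩
  have hr0 : r = 2 * ellipticK k * ellipticD k := by rw [← hL, ellipticL_eq]
  -- All radicals are expressed through c: √a = c(1 + k), √b = c(1 - k), √(r/2) = cD and √(2/r) =
  -- c/K.
  set c := Real.sqrt (ellipticK k / ellipticD k) with hc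
  have hc0 : 0 < c := Real.sqrt_pos.2 (by positivity)
  have hcsq : c ^ 2 = ellipticK k / ellipticD k := Real.sq_sqrt (by positivity)
  have hcD : c * ellipticD k = Real.sqrt (r / 2) := by
    symm
    rw [Real.sqrt_eq_iff_mul_self_eq_of_pos (by positivity)]
    calc c * ellipticD k * (c * ellipticD k) = c ^ 2 * ellipticD k ^ 2 := by ring
      _ = r / 2 := by rw [hcsq, hr0]; field_simp
  have hcK : c / ellipticK k = Real.sqrt (2 / r) := by
    symm
    rw [Real.sqrt_eq_iff_mul_self_eq_of_pos (by positivity)]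
    calc c / ellipticK k * (c / ellipticK k) = c ^ 2 / ellipticK k ^ 2 := by ring
      _ = 2 / r := by rw [hcsq, hr0]; field_simp
  have ha : Real.sqrt (ellipticK k / ellipticD k * (1 + k) ^ 2) = c * (1 + k) := by
    rw [← hcsq, ← mul_pow, Real.sqrt_sq (by positivity)]
  have hb : Real.sqrt (ellipticK k / ellipticD k * (1 - k) ^ 2) = c * (1 - k) := by
    rw [← hcsq, ← mul_pow, Real.sqrt_sq (by positivity)]
  have hβ : Real.sqrt (r / 2) * (c * (1 + k) + c * (1 - k)) = 2 * ellipticK k := by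
    rw [← hcD]
    calc _ = 2 * c ^ 2 * ellipticD k := by ring
      _ = _ := by rw [hcsq]; field_simp
  refine ⟨ellipticK k / ellipticD k * (1 + k) ^ 2, ellipticK k / ellipticD k * (1 - k) ^ 2,
    2 * ellipticK k, by positivity, by positivity, rfl, rfl, ?_, ?_, rfl, ?_,
    fun t => ellipticK k / ellipticD k * dnCnSq k (2 * ellipticK k * t), ?_, ?_,
    hL ▸ isDelaySolution_profile hk', ?_, ?_, ⟨-1, ?_⟩, ?_, integral_profile_period hk'⟩
  · rw [ha, hb]
    field_simp
    ring
  · rw [ha, hb, hβ]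
  · rw [Real.sqrt_mul (by positivity : 0 ≤ ellipticK k / ellipticD k * (1 + k) ^ 2), ha, hb,
      ← hcK]
    have e : (c * (1 + k) + c * (1 - k)) * (c / ellipticK k) * ellipticE k
        - c * (1 + k) * (c * (1 - k))
        = c ^ 2 * (2 * ellipticE k - ellipticK k * (1 - k ^ 2)) / ellipticK k := by
      field_simp
      ring
    rw [e, hcsq, ← ellipticD]
    field_simp
  · intro t
    simp only [dnCnSq]
    field_simp
  · intro t
    have h1 := jacobiDn_sub_pos hk' (2 * ellipticK k * t)
    have h2 := jacobiDn_sq_sub hk' (2 * ellipticK k * t)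
    have h3 : jacobiDn (2 * ellipticK k * t) k + k * jacobiCn (2 * ellipticK k * t) k
        = (1 + k) * ((1 - k)
          / (jacobiDn (2 * ellipticK k * t) k - k * jacobiCn (2 * ellipticK k * t) k)) := by
      rw [← mul_div_assoc, eq_div_iff h1.ne']
      linear_combination h2
    simp only [dnCnSq]
    rw [h3]
    ring
  · intro t
    have := dnCnSq_pos hk' (2 * ellipticK k * t)
    positivity
  · intro t
    have e : 2 * ellipticK k * (t - 2)
        = 2 * ellipticK k * t - 2 * ellipticK k - 2 * ellipticK k := by
      ring
    simp only [dnCnSq]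
    rw [e, jacobiDn_sub_two_mul_ellipticK hk', jacobiCn_sub_two_mul_ellipticK hk',
      jacobiDn_sub_two_mul_ellipticK hk', jacobiCn_sub_two_mul_ellipticK hk', neg_neg]
  -- Half a period before 0, cn is -1 instead of 1, so x(-1) = b while x(0) = a; these differ
  -- because k > 0.
  · have e : 2 * ellipticK k * -1 = 0 - 2 * ellipticK k := by ring
    simp only [dnCnSq]
    rw [e, jacobiDn_sub_two_mul_ellipticK hk', jacobiCn_sub_two_mul_ellipticK hk', mul_zero,
      jacobiDn_eq, jacobiCn, jacobiAm_zero hk', Real.cos_zero]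
    have h0 : legendreDelta k 0 = 1 := by simp [legendreDelta]
    rw [h0]
    intro h
    have := mul_left_cancel₀ (by positivity) h
    linarith
  · intro t
    have h := dnCnSq_mul_sub hk' (2 * ellipticK k * t)
    beta_reduce
    rw [mul_sub (2 * ellipticK k), mul_one]
    linear_combination (ellipticK k / ellipticD k) ^ 2 * h
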